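/- Let $c_F>0$ and $\tau>4$. There is a constant $c_3\in(0,\infty)$, depending only on $c_F$ and $\tau$, such that the following holds. Let $W$ be a random variable with values in $(0,\infty)$ and distribution function $F$, such that $1-F(x)\le c_F x^{-(\tau-1)}$ for all $x>0$, and suppose that $F$ is critical, that is, $\nu:=\mathbb{E}(W^2)/\mathbb{E}(W)=1$. For $n\ge 1$ and $j\in\{1,\dots,n\}$ put $w_j=[1-F]^{-1}(j/n)$, where $[1-F]^{-1}(u)=\inf\{s>0: 1-F(s)\le u\}$ (so that $[1-F]^{-1}(1)=0$), and let $l_n=\sum_{j=1}^n w_j$. Let $NR_n(\mathbf{w})$ be the random graph with vertex set $\{1,\dots,n\}$ in which the edges $\{i,j\}$, $1\le i<j\le n$, are present independently, with probability $1-e^{-w_iw_j/l_n}$ (read as $0$ if $l_n=0$), and let $|\mathcal{C}_{\max}|$ be the number of vertices of a largest connected component of it. Then for every $A>1$ there is an $n_0$ (which may depend on $F$ and $A$) such that for all $n\ge n_0$ $$\mathbb{P}\big(|\mathcal{C}_{\max}|>\lceil An^{2/3}\rceil\big)\le \frac{c_3}{A^{3/2}}.$$ -/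

import Mathlib

open MeasureTheory ProbabilityTheory Filter
open scoped NNReal unitInterval

noncomputable section

namespace CriticalNR

/-- The generalized inverse `[1 - F]⁻¹(u) = inf {s ∈ (0, ∞) : 1 - F(s) ≤ u}` of the tail of the
distribution function `F` of the law `μ` of a positive random variable.
At `u = 1` this is `inf (0, ∞) = 0`. -/
def tailInv (μ : Measure ℝ) (u : ℝ) : ℝ :=
  sInf {s : ℝ | 0 < s ∧ 1 - cdf μ s ≤ u}

theorem tailInv_nonneg (μ : Measure ℝ) (u : ℝ) : 0 ≤ tailInv μ u :=
  Real.sInf_nonneg fun _ hs => hs.1.le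

theorem tailInv_one (μ : Measure ℝ) : tailInv μ 1 = 0 := by
  have h : {s : ℝ | 0 < s ∧ 1 - cdf μ s ≤ 1} = Set.Ioi 0 := by
    ext s
    simpa using fun _ => cdf_nonneg μ s
  rw [tailInv, h, csInf_Ioi]

/-- The weights `w_j = [1 - F]⁻¹(j / n)`, `j = 1, …, n`; the vertex `j` is the element
`j - 1` of `Fin n`. -/
def weight (μ : Measure ℝ) (n : ℕ) (i : Fin n) : ℝ≥0 :=
  ⟨tailInv μ (((i : ℕ) + 1 : ℝ) / n), tailInv_nonneg _ _⟩

/-- The parameter `ν = E(W²) / E(W)` of a random variable `W` with law `μ`. -/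
def nu (μ : Measure ℝ) : ℝ := (∫ x, x ^ 2 ∂μ) / ∫ x, x ∂μ

/-- The edge probability `1 - exp (- w_i w_j / l_n)` with `l_n = ∑ w_k`. -/
def edgeProb {n : ℕ} (w : Fin n → ℝ≥0) (i j : Fin n) : I :=
  ⟨1 - Real.exp (-((w i : ℝ) * w j / ∑ k, (w k : ℝ))), by
    have h : (0 : ℝ) ≤ (w i : ℝ) * w j / ∑ k, (w k : ℝ) := by positivity
    have h1 : Real.exp (-((w i : ℝ) * w j / ∑ k, (w k : ℝ))) ≤ 1 := by
      simpa using h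
    exact ⟨by linarith, by linarith [Real.exp_pos (-((w i : ℝ) * w j / ∑ k, (w k : ℝ)))]⟩⟩

/-- The pairs `i < j` of vertices, that is, the possible edges. -/
abbrev Pair (n : ℕ) : Type := {e : Fin n × Fin n // e.1 < e.2}

/-- The graph on `Fin n` whose edges are the pairs `e` with `ω e`. -/
def graphOf {n : ℕ} (ω : Pair n → Prop) : SimpleGraph (Fin n) :=
  SimpleGraph.fromRel fun i j => ∃ h : i < j, ω ⟨(i, j), h⟩

/-- The law of the Norros–Reittu random graph with weights `w`: the pairs `i < j` are edges
independently of each other, each with probability `1 - exp (- w_i w_j / l_n)`. -/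
def norrosReittu {n : ℕ} (w : Fin n → ℝ≥0) : Measure (SimpleGraph (Fin n)) :=
  (Measure.pi fun e : Pair n =>
    bernoulliMeasure True False (edgeProb w e.1.1 e.1.2)).map graphOf

theorem measurable_graphOf {n : ℕ} : Measurable (graphOf (n := n)) :=
  measurable_of_countable _

instance isProbabilityMeasure_norrosReittu {n : ℕ} (w : Fin n → ℝ≥0) : IsProbabilityMeasure (norrosReittu w) :=
  Measure.isProbabilityMeasure_map measurable_graphOf.aemeasurable

/-- The size of the component of the vertex `v`. -/
def clusterSize {V : Type*} (G : SimpleGraph V) (v : V) : ℕ := {u | G.Reachable v u}.ncard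

/-- The size of a largest component. -/
def maxClusterSize {V : Type*} [Fintype V] (G : SimpleGraph V) : ℕ :=
  Finset.univ.sup (clusterSize G)

end CriticalNR

end

namespace CriticalNR

/-! ### Ghost field recursion from exploring one vertex. -/

section Exploration

/-! Join each vertex to a ghost independently with probability `1 - exp (-h)`, and let `g v` be the
probability that the cluster of `v` meets the ghost. Conditioning on the edges away from `v` and
applying Jensen's inequality gives `1 - g v ≥ exp (-(h + w v * S))`, where `S` is the size-biased
mean of `g` (`exp_le_one_sub_ghostProb`).

Averaging again with size bias, near-criticality `∑ w² ≤ ∑ w + δ` cancels the linear term in `S`.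
The quadratic term remains, so `S` is of order `√h` up to a `δ` correction (`sum_ghostProb_le`).

A cluster larger than `K` makes at least `K` vertices likely to meet the ghost when `h = 1/K`.
Markov's inequality then bounds the tail by a multiple of `n/K² + δ/K + n/K^(3/2)`
(`norrosReittu_real_le`). At `K = A n^(2/3)` the last term is `A^(-3/2)`. Comparing Riemann sums
with integrals allows `δ = √n` (`weight_bounds`), so `δ/K` vanishes in the limit. -/

theorem integral_bernoulli_ite (p : I) (a : ℝ) [DecidablePred fun b : Prop => b] :
    ∫ b, (if b then a else 1) ∂(bernoulliMeasure True False p) = 1 - p * (1 - a) := by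
  rw [integral_bernoulliMeasure]
  simp
  ring

/-- Convexity of `exp` on the segment from `-x` to `0`. It turns the factor of an edge of
probability `1 - exp (-x)` into an exponential, so that the product over edges becomes a sum in the
exponent. -/
theorem exp_neg_mul_le_one_sub {x a : ℝ} (ha0 : 0 ≤ a) (ha1 : a ≤ 1) :
    Real.exp (-(x * (1 - a))) ≤ 1 - (1 - Real.exp (-x)) * (1 - a) := by
  have h := convexOn_exp.2 (Set.mem_univ (-x)) (Set.mem_univ 0) (sub_nonneg.2 ha1) ha0 (by ring)
  simp only [smul_eq_mul, mul_zero, add_zero, Real.exp_zero, mul_one] at h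
  calc Real.exp (-(x * (1 - a))) = Real.exp ((1 - a) * -x) := by congr 1; ring
    _ ≤ _ := h
    _ = _ := by ring

/-- Jensen's inequality for the exponential function. -/
theorem exp_integral_le {Ω : Type*} [MeasurableSpace Ω] {P : Measure Ω} [IsProbabilityMeasure P]
    {f : Ω → ℝ} (hf : Integrable f P) (hef : Integrable (fun ω => Real.exp (f ω)) P) :
    Real.exp (∫ ω, f ω ∂P) ≤ ∫ ω, Real.exp (f ω) ∂P :=
  convexOn_exp.map_integral_le Real.continuous_exp.continuousOn isClosed_univ (by simp) hf hef

open Classical in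
/-- Integrate out the coordinates in `Q` first, then use Jensen's inequality for the others. -/
theorem exp_neg_sum_le_integral_prod_ite {ι : Type*} [Fintype ι] (Q : ι → Prop) (p : ι → I)
    (x : ι → ℝ) (hp : ∀ e, (p e : ℝ) = 1 - Real.exp (-x e))
    (a : ι → ({e // ¬ Q e} → Prop) → ℝ) (ha0 : ∀ e η, 0 ≤ a e η) (ha1 : ∀ e η, a e η ≤ 1) :
    Real.exp (-∑ e : {e // Q e}, x e * ∫ ω : ι → Prop, (1 - a e fun i => ω i)
        ∂(Measure.pi fun e => bernoulliMeasure True False (p e)))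
      ≤ ∫ ω : ι → Prop, ∏ e : {e // Q e}, (if ω e then a e fun i => ω i else 1)
        ∂(Measure.pi fun e => bernoulliMeasure True False (p e)) := by
  set μ : ι → Measure Prop := fun e => bernoulliMeasure True False (p e) with hμ
  have hmp := measurePreserving_piEquivPiSubtypeProd μ Q
  set P₁ := Measure.pi fun i : {e // Q e} => μ i
  set P₂ := Measure.pi fun i : {e // ¬ Q e} => μ i
  have h₁ : ∀ e, ∫ ω : ι → Prop, (1 - a e fun i => ω i) ∂(Measure.pi μ)
      = ∫ η, (1 - a e η) ∂P₂ := by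
    intro e
    refine (hmp.integral_comp' fun z => 1 - a e z.2).trans ?_
    simpa using integral_fun_snd (μ := P₁) (ν := P₂) fun η => 1 - a e η
  have h₂ : ∫ ω : ι → Prop, ∏ e : {e // Q e}, (if ω e then a e fun i => ω i else 1) ∂(Measure.pi μ)
      = ∫ η, ∏ e : {e // Q e}, (1 - p e * (1 - a e η)) ∂P₂ := by
    refine (hmp.integral_comp' fun z : ({e // Q e} → Prop) × ({e // ¬ Q e} → Prop) =>
      ∏ e : {e // Q e}, (if z.1 e then a e z.2 else 1)).trans ?_
    rw [integral_prod_symm _ Integrable.of_finite]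
    refine integral_congr_ae (ae_of_all _ fun η => ?_)
    refine (integral_fintype_prod_eq_prod (μ := fun e : {e // Q e} => μ e)
      fun (e : {e // Q e}) (b : Prop) => if b then a e η else 1).trans ?_
    exact Finset.prod_congr rfl fun e _ => integral_bernoulli_ite _ _
  have h₃ : ∀ η, Real.exp (-∑ e : {e // Q e}, x e * (1 - a e η))
      ≤ ∏ e : {e // Q e}, (1 - p e * (1 - a e η)) := by
    intro η
    rw [← Finset.sum_neg_distrib, Real.exp_sum]
    refine Finset.prod_le_prod (fun _ _ => (Real.exp_pos _).le) fun e _ => ?_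
    rw [hp]
    exact exp_neg_mul_le_one_sub (ha0 _ _) (ha1 _ _)
  have h₄ : -∑ e : {e // Q e}, x e * ∫ η, (1 - a e η) ∂P₂
      = ∫ η, -∑ e : {e // Q e}, x e * (1 - a e η) ∂P₂ := by
    rw [integral_neg, integral_finsetSum _ fun _ _ => Integrable.of_finite]
    simp only [integral_const_mul]
  simp only [h₁]
  rw [h₂, h₄]
  exact (exp_integral_le Integrable.of_finite Integrable.of_finite).trans
    (integral_mono Integrable.of_finite Integrable.of_finite h₃)

variable {n : ℕ}

theorem graphOf_adj {ω : Pair n → Prop} {i j : Fin n} :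
    (graphOf ω).Adj i j ↔ (∃ h : i < j, ω ⟨(i, j), h⟩) ∨ ∃ h : j < i, ω ⟨(j, i), h⟩ := by
  rw [graphOf, SimpleGraph.fromRel_adj]
  refine ⟨And.right, fun h => ⟨?_, h⟩⟩
  rcases h with ⟨h, -⟩ | ⟨h, -⟩
  exacts [h.ne, h.ne']

/-- The pair `e` contains the vertex `v`. -/
def Touches (v : Fin n) (e : Pair n) : Prop := e.1.1 = v ∨ e.1.2 = v

open Classical in
/-- The end of the pair `e` that is not `v`. -/
noncomputable def other (v : Fin n) (e : Pair n) : Fin n := if e.1.1 = v then e.1.2 else e.1.1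

/-- The graph spanned by the edges away from `v`. -/
noncomputable def graphAway (v : Fin n) (η : {e // ¬ Touches v e} → Prop) : SimpleGraph (Fin n) :=
  graphOf fun e => ∃ h : ¬ Touches v e, η ⟨e, h⟩

theorem graphAway_le (v : Fin n) (ω : Pair n → Prop) :
    graphAway v (fun e => ω e) ≤ graphOf ω := by
  intro i j h
  rw [graphAway, graphOf_adj] at h
  rw [graphOf_adj]
  rcases h with ⟨h, _, h'⟩ | ⟨h, _, h'⟩
  exacts [Or.inl ⟨h, h'⟩, Or.inr ⟨h, h'⟩]

theorem graphAway_adj {v : Fin n} {ω : Pair n → Prop} {i j : Fin n} (h : (graphOf ω).Adj i j)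
    (hi : i ≠ v) (hj : j ≠ v) : (graphAway v fun e => ω e).Adj i j := by
  rw [graphOf_adj] at h
  rw [graphAway, graphOf_adj]
  rcases h with ⟨h, h'⟩ | ⟨h, h'⟩
  · exact Or.inl ⟨h, fun ht => ht.elim hi hj, h'⟩
  · exact Or.inr ⟨h, fun ht => ht.elim hj hi, h'⟩

theorem exists_touches_of_adj {v : Fin n} {ω : Pair n → Prop} {j : Fin n}
    (h : (graphOf ω).Adj v j) : ∃ e, Touches v e ∧ ω e ∧ other v e = j := by
  rw [graphOf_adj] at h
  rcases h with ⟨h, h'⟩ | ⟨h, h'⟩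
  · exact ⟨_, Or.inl rfl, h', if_pos rfl⟩
  · exact ⟨_, Or.inr rfl, h', if_neg h.ne⟩

theorem clusterSize_mono {G H : SimpleGraph (Fin n)} (h : G ≤ H) (v : Fin n) :
    clusterSize G v ≤ clusterSize H v :=
  Set.ncard_le_ncard (fun _ hu => SimpleGraph.Reachable.mono h hu) (Set.toFinite _)

/-- Cut a path from `v` to `u` at its last visit to `v`: the rest is one edge at `v` followed by a
path avoiding `v`. -/
theorem exists_reachable_graphAway {v u : Fin n} {ω : Pair n → Prop}
    (h : (graphOf ω).Reachable v u) :
    u = v ∨ ∃ e, Touches v e ∧ ω e ∧ (graphAway v fun e => ω e).Reachable (other v e) u := by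
  rw [SimpleGraph.reachable_iff_reflTransGen] at h
  induction h with
  | refl => exact Or.inl rfl
  | @tail y z _ hyz ih =>
    by_cases hz : z = v
    · exact Or.inl hz
    right
    by_cases hy : y = v
    · subst hy
      obtain ⟨e, he, hω, rfl⟩ := exists_touches_of_adj hyz
      exact ⟨e, he, hω, SimpleGraph.Reachable.refl _⟩
    · obtain ⟨e, he, hω, hr⟩ := ih.resolve_left hy
      exact ⟨e, he, hω, hr.trans (graphAway_adj hyz hy hz).reachable⟩

open Classical in
-- A union bound over the open edges at `v`. Clusters of different neighbours may coincide, which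
-- only helps the upper bound.
theorem clusterSize_le_one_add_sum (v : Fin n) (ω : Pair n → Prop) :
    clusterSize (graphOf ω) v ≤ 1 + ∑ e : {e // Touches v e},
      if ω e then clusterSize (graphAway v fun e => ω e) (other v e) else 0 := by
  have hsub : {u | (graphOf ω).Reachable v u} ⊆ {v} ∪ ⋃ e : {e // Touches v e},
      {u | ω e ∧ (graphAway v fun e => ω e).Reachable (other v e) u} := by
    intro u hu
    rcases exists_reachable_graphAway hu with rfl | ⟨e, he, h⟩
    · exact Or.inl rfl
    · exact Or.inr (Set.mem_iUnion.2 ⟨⟨e, he⟩, h⟩)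
  refine (Set.ncard_le_ncard hsub (Set.toFinite _)).trans ((Set.ncard_union_le _ _).trans ?_)
  rw [Set.ncard_singleton]
  gcongr
  refine (Set.ncard_iUnion_le_of_fintype _).trans (Finset.sum_le_sum fun e _ => ?_)
  split_ifs with h <;> simp [h, clusterSize]

/-- The law of the edge indicators of the Norros–Reittu graph. -/
noncomputable def edgeLaw (w : Fin n → ℝ≥0) : Measure (Pair n → Prop) :=
  Measure.pi fun e : Pair n => bernoulliMeasure True False (edgeProb w e.1.1 e.1.2)

instance (w : Fin n → ℝ≥0) : IsProbabilityMeasure (edgeLaw w) := by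
  unfold edgeLaw; infer_instance

/-- The probability that the cluster of `v` meets a random set of vertices that contains each
vertex independently with probability `1 - exp (-h)`. -/
noncomputable def ghostProb (w : Fin n → ℝ≥0) (h : ℝ) (v : Fin n) : ℝ :=
  ∫ ω, (1 - Real.exp (-(h * clusterSize (graphOf ω) v))) ∂(edgeLaw w)

theorem ghostProb_nonneg (w : Fin n → ℝ≥0) {h : ℝ} (hh : 0 ≤ h) (v : Fin n) :
    0 ≤ ghostProb w h v := by
  refine integral_nonneg fun ω => sub_nonneg.2 (Real.exp_le_one_iff.2 ?_)
  exact neg_nonpos.2 (by positivity)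

theorem other_injOn (v : Fin n) : Set.InjOn (other v) {e | Touches v e} := by
  rintro ⟨⟨i, j⟩, hij⟩ he ⟨⟨k, l⟩, hkl⟩ hf h
  simp only [Touches, other, Set.mem_ofPred_eq] at he hf h hij hkl
  simp only [Subtype.mk.injEq, Prod.mk.injEq]
  split_ifs at h <;> grind

open Classical in
-- Each edge at `v` is determined by its other end, so this is a sum over vertices with the
-- nonnegative term `u = v` missing.
theorem sum_touches_le {w : Fin n → ℝ≥0} {f : Fin n → ℝ} (hf : ∀ u, 0 ≤ f u) (v : Fin n) :
    ∑ e : {e : Pair n // Touches v e}, (w e.1.1.1 * w e.1.1.2 / ∑ k, (w k : ℝ)) * f (other v e)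
      ≤ w v * ((∑ u, w u * f u) / ∑ k, (w k : ℝ)) := by
  have h : ∀ e : {e : Pair n // Touches v e},
      (w e.1.1.1 * w e.1.1.2 / ∑ k, (w k : ℝ)) * f (other v e)
        = w v * (w (other v e) * f (other v e) / ∑ k, (w k : ℝ)) := by
    rintro ⟨⟨⟨i, j⟩, hij⟩, he⟩
    simp only [Touches] at he
    simp only [other]
    split_ifs with h
    · subst h; ring
    · obtain rfl := he.resolve_left h; ring
  rw [Finset.sum_congr rfl fun e _ => h e, ← Finset.mul_sum, Finset.sum_div]
  refine mul_le_mul_of_nonneg_left ?_ (w v).2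
  refine (Finset.sum_map Finset.univ ⟨fun e : {e : Pair n // Touches v e} => other v e,
    fun e f hef => Subtype.ext (other_injOn v e.2 f.2 hef)⟩
    fun u => w u * f u / ∑ k, (w k : ℝ)).symm.trans_le ?_
  refine Finset.sum_le_sum_of_subset_of_nonneg (Finset.subset_univ _) fun u _ _ => ?_
  have := hf u
  positivity

/-- The recursive bound for the ghost connection probabilities. -/
theorem exp_le_one_sub_ghostProb (w : Fin n → ℝ≥0) {h : ℝ} (hh : 0 ≤ h) (v : Fin n) :
    Real.exp (-(h + w v * ((∑ u, w u * ghostProb w h u) / ∑ k, (w k : ℝ))))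
      ≤ 1 - ghostProb w h v := by
  classical
  set x : Pair n → ℝ := fun e => w e.1.1 * w e.1.2 / ∑ k, (w k : ℝ) with hx
  have hx0 : ∀ e, 0 ≤ x e := fun e => by positivity
  set a : Pair n → ({e // ¬ Touches v e} → Prop) → ℝ := fun e η =>
    Real.exp (-(h * clusterSize (graphAway v η) (other v e))) with ha
  have ha1 : ∀ e η, a e η ≤ 1 := fun e η =>
    Real.exp_le_one_iff.2 (neg_nonpos.2 (by positivity))
  have hJ := exp_neg_sum_le_integral_prod_ite (Touches v)
    (fun e : Pair n => edgeProb w e.1.1 e.1.2) x (fun _ => rfl) a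
    (fun _ _ => (Real.exp_pos _).le) ha1
  have hpt : ∀ ω : Pair n → Prop, Real.exp (-h) *
      ∏ e : {e // Touches v e}, (if ω e then a e fun i => ω i else 1)
        ≤ Real.exp (-(h * clusterSize (graphOf ω) v)) := by
    intro ω
    have h₁ : ∏ e : {e // Touches v e}, (if ω e then a e fun i => ω i else 1)
        = Real.exp (∑ e : {e // Touches v e}, -(h *
          (if ω e then clusterSize (graphAway v fun e => ω e) (other v e) else 0 : ℕ))) := by
      rw [Real.exp_sum]
      refine Finset.prod_congr rfl fun e _ => ?_
      split_ifs <;> simp [ha]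
    rw [h₁, ← Real.exp_add, Real.exp_le_exp, Finset.sum_neg_distrib, ← Finset.mul_sum,
      ← Nat.cast_sum]
    have h₂ := mul_le_mul_of_nonneg_left
      (Nat.cast_le (α := ℝ).2 (clusterSize_le_one_add_sum v ω)) hh
    rw [Nat.cast_add, Nat.cast_one] at h₂
    linarith
  have hint : 1 - ghostProb w h v
      = ∫ ω, Real.exp (-(h * clusterSize (graphOf ω) v)) ∂(edgeLaw w) := by
    rw [ghostProb, integral_sub Integrable.of_finite Integrable.of_finite]
    simp
  -- Clusters away from `v` are no larger than full clusters, so full ghost probabilities close the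
  -- recursion.
  have hle : ∑ e : {e // Touches v e}, x e * ∫ ω, (1 - a e fun i => ω i) ∂(edgeLaw w)
      ≤ w v * ((∑ u, w u * ghostProb w h u) / ∑ k, (w k : ℝ)) := by
    refine le_trans (Finset.sum_le_sum fun e _ => mul_le_mul_of_nonneg_left ?_ (hx0 e))
      (sum_touches_le (fun u => ghostProb_nonneg w hh u) v)
    refine integral_mono Integrable.of_finite Integrable.of_finite fun ω => ?_
    simp only [ha]
    have := clusterSize_mono (graphAway_le v ω) (other v e)
    gcongr
  calc _ ≤ Real.exp (-h) * Real.exp (-∑ e : {e // Touches v e},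
          x e * ∫ ω, (1 - a e fun i => ω i) ∂(edgeLaw w)) := by
        rw [← Real.exp_add, Real.exp_le_exp]; linarith
    _ ≤ Real.exp (-h) * ∫ ω, ∏ e : {e // Touches v e}, (if ω e then a e fun i => ω i else 1)
          ∂(edgeLaw w) := mul_le_mul_of_nonneg_left hJ (Real.exp_pos _).le
    _ ≤ 1 - ghostProb w h v := by
        rw [hint, ← integral_const_mul]
        exact integral_mono Integrable.of_finite Integrable.of_finite hpt

end Exploration

/-! ### From the recursion to the tail of the largest cluster. -/

section LargestCluster

variable {n : ℕ}

/-- In essence `-log (1 - S) ≥ S + S² / 2`. The weaker constant `1/4` permits a polynomial proof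
through `exp (-t) ≥ (1 - t/2)²`. The quadratic gain is the source of `√h`. -/
theorem add_sq_le_of_le_one_sub_exp {S y : ℝ} (hS : 0 ≤ S) (h : S ≤ 1 - Real.exp (-y)) :
    S + S ^ 2 / 4 ≤ y := by
  have hS1 : S < 1 := by linarith [Real.exp_pos (-y)]
  set t := S + S ^ 2 / 4 with ht
  have h₁ : (1 - t / 2) ^ 2 ≤ Real.exp (-t) := by
    rw [show -t = -(t / 2) + -(t / 2) by ring, Real.exp_add, ← sq]
    refine pow_le_pow_left₀ (by nlinarith) ?_ 2
    linarith [Real.add_one_le_exp (-(t / 2))]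
  have h₂ : 1 - S ≤ (1 - t / 2) ^ 2 := by
    have : (1 - t / 2) ^ 2 = 1 - S + (S ^ 3 / 8 + S ^ 4 / 64) := by rw [ht]; ring
    have : 0 ≤ S ^ 3 / 8 + S ^ 4 / 64 := by positivity
    linarith
  have h₃ : Real.exp (-y) ≤ Real.exp (-t) := by linarith
  linarith [Real.exp_le_exp.1 h₃]

/-- The ghost field estimate: the mean number of vertices connected to the ghost is of order
`√h` for weights that are nearly critical. -/
theorem sum_ghostProb_le (w : Fin n → ℝ≥0) {h δ : ℝ} (hh : 0 ≤ h) (hδ : 0 ≤ δ)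
    (hw : ∑ v, (w v : ℝ) ^ 2 ≤ ∑ v, (w v : ℝ) + δ) :
    ∑ v, ghostProb w h v ≤ n * h + (4 * δ + 2 * (∑ v, (w v : ℝ)) * √h) := by
  set l := ∑ v, (w v : ℝ) with hl
  have hl0 : 0 ≤ l := by positivity
  set S := (∑ u, w u * ghostProb w h u) / l with hS
  have hS0 : 0 ≤ S := div_nonneg
    (Finset.sum_nonneg fun u _ => mul_nonneg (w u).2 (ghostProb_nonneg w hh u)) hl0
  have hrec : ∀ v, ghostProb w h v ≤ 1 - Real.exp (-(h + w v * S)) := fun v => by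
    linarith [exp_le_one_sub_ghostProb w hh v]
  have hsum : ∑ v, ghostProb w h v ≤ n * h + l * S := by
    calc ∑ v, ghostProb w h v ≤ ∑ v, (h + w v * S) := Finset.sum_le_sum fun v _ => by
          linarith [hrec v, Real.add_one_le_exp (-(h + w v * S))]
      _ = n * h + l * S := by simp [Finset.sum_add_distrib, ← Finset.sum_mul, hl]
  refine hsum.trans (add_le_add_right ?_ _)
  rcases hl0.eq_or_lt with h0 | hlpos
  · rw [← h0]; simp; exact hδ
  -- An upper bound, by `hw`, for the size-biased mean of the exponents `h + w v * S`. The tangent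
  -- to `exp` at `-y` then acts as Jensen's inequality.
  set y := h + S + δ * S / l with hy
  have hlS : l * S = ∑ u, w u * ghostProb w h u := by rw [hS]; field_simp
  have hkey : S ≤ 1 - Real.exp (-y) := by
    have h₁ : ∀ v, w v * ghostProb w h v
        ≤ w v * (1 - Real.exp (-y) * (1 + y - h - w v * S)) := fun v => by
      refine mul_le_mul_of_nonneg_left ((hrec v).trans ?_) (w v).2
      have := mul_le_mul_of_nonneg_left (Real.add_one_le_exp (-(h + w v * S) + y))
        (Real.exp_pos (-y)).le
      rw [← Real.exp_add, show -y + (-(h + w v * S) + y) = -(h + w v * S) by ring] at this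
      linarith
    have h₂ : l * S ≤ l - Real.exp (-y) * (l * (1 + y - h) - S * ∑ v, (w v : ℝ) ^ 2) := by
      rw [hlS]
      refine (Finset.sum_le_sum fun v _ => h₁ v).trans_eq ?_
      rw [hl, Finset.sum_mul, Finset.mul_sum, ← Finset.sum_sub_distrib, Finset.mul_sum,
        ← Finset.sum_sub_distrib]
      exact Finset.sum_congr rfl fun v _ => by ring
    have h₃ : l ≤ l * (1 + y - h) - S * ∑ v, (w v : ℝ) ^ 2 := by
      have e : l * (1 + y - h) = l + S * (l + δ) := by rw [hy]; field_simp; ring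
      rw [e]
      linarith [mul_le_mul_of_nonneg_left hw hS0]
    have h₄ := mul_le_mul_of_nonneg_left h₃ (Real.exp_pos (-y)).le
    refine le_of_mul_le_mul_left ?_ hlpos
    linarith
  have hsq := add_sq_le_of_le_one_sub_exp hS0 hkey
  have hX : (l * S) ^ 2 ≤ 4 * l ^ 2 * h + 4 * δ * (l * S) := by
    have h₁ : l ^ 2 * (S ^ 2 / 4) ≤ l ^ 2 * (h + δ * S / l) :=
      mul_le_mul_of_nonneg_left (by linarith) (by positivity)
    have h₂ : l ^ 2 * (h + δ * S / l) = l ^ 2 * h + δ * (l * S) := by field_simp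
    linarith
  -- With `X = l * S` and `r = 2 * l * √h`, `hX` reads `X² ≤ r² + 4δX`, which fails once `X > 4δ +
  -- r`.
  by_contra! hlt
  have hX0 : 0 ≤ l * S := by positivity
  have hr : 0 ≤ 2 * l * √h := by positivity
  have hr2 : (2 * l * √h) ^ 2 = 4 * l ^ 2 * h := by rw [mul_pow, Real.sq_sqrt hh]; ring
  nlinarith

theorem clusterSize_eq_of_reachable {G : SimpleGraph (Fin n)} {u v : Fin n}
    (h : G.Reachable v u) : clusterSize G u = clusterSize G v := by
  unfold clusterSize
  congr 1
  ext x
  exact ⟨h.trans, h.symm.trans⟩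

/-- If the largest cluster has more than `K` vertices, then more than `K` vertices lie in
clusters with more than `K` vertices. -/
theorem mul_le_sum_of_lt_maxClusterSize {G : SimpleGraph (Fin n)} {K h : ℝ} (hK : 0 ≤ K)
    (hh : 0 ≤ h) (hG : K < maxClusterSize G) :
    K * (1 - Real.exp (-(h * K))) ≤ ∑ v, (1 - Real.exp (-(h * clusterSize G v))) := by
  classical
  obtain ⟨v, hv⟩ : ∃ v, K < clusterSize G v := by
    by_contra! hv
    have : maxClusterSize G ≤ ⌊K⌋₊ := Finset.sup_le fun v _ => Nat.le_floor (hv v)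
    exact absurd hG (not_lt.2 ((Nat.cast_le.2 this).trans (Nat.floor_le hK)))
  have hnn : ∀ k : ℝ, 0 ≤ k → 0 ≤ 1 - Real.exp (-(h * k)) := fun k hk =>
    sub_nonneg.2 (Real.exp_le_one_iff.2 (neg_nonpos.2 (by positivity)))
  have hcard : clusterSize G v = (Finset.univ.filter fun u => G.Reachable v u).card := by
    rw [clusterSize, ← Set.ncard_coe_finset]; simp
  calc K * (1 - Real.exp (-(h * K)))
      ≤ clusterSize G v * (1 - Real.exp (-(h * K))) :=
        mul_le_mul_of_nonneg_right hv.le (hnn K hK)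
    _ = ∑ u with G.Reachable v u, (1 - Real.exp (-(h * K))) := by
        rw [Finset.sum_const, nsmul_eq_mul, hcard]
    _ ≤ ∑ u with G.Reachable v u, (1 - Real.exp (-(h * clusterSize G u))) := by
        refine Finset.sum_le_sum fun u hu => ?_
        rw [clusterSize_eq_of_reachable (Finset.mem_filter.1 hu).2]
        gcongr
    _ ≤ _ := Finset.sum_le_sum_of_subset_of_nonneg (Finset.filter_subset _ _)
        fun u _ _ => hnn _ (Nat.cast_nonneg _)

theorem measurableSet_simpleGraph (s : Set (SimpleGraph (Fin n))) : MeasurableSet s := by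
  have := SimpleGraph.measurableEmbedding_edgeSet (V := Fin n)
  rw [← Set.preimage_image_eq s SimpleGraph.edgeSet_injective]
  exact this.measurable (Set.toFinite _).measurableSet

/-- Markov's inequality: integrate `mul_le_sum_of_lt_maxClusterSize` over the event. -/
theorem norrosReittu_real_mul_le (w : Fin n → ℝ≥0) {K h : ℝ} (hK : 0 ≤ K) (hh : 0 ≤ h) :
    (norrosReittu w).real {G | K < maxClusterSize G} * (K * (1 - Real.exp (-(h * K))))
      ≤ ∑ v, ghostProb w h v := by
  have hm : (norrosReittu w).real {G | K < maxClusterSize G}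
      = (edgeLaw w).real {ω | K < maxClusterSize (graphOf ω)} :=
    map_measureReal_apply measurable_graphOf (measurableSet_simpleGraph _)
  have hms : MeasurableSet {ω : Pair n → Prop | K < maxClusterSize (graphOf ω)} :=
    (Set.toFinite _).measurableSet
  rw [hm, ← smul_eq_mul, ← setIntegral_const, ← integral_indicator hms]
  simp only [ghostProb]
  rw [← integral_finsetSum _ fun _ _ => Integrable.of_finite]
  refine integral_mono Integrable.of_finite Integrable.of_finite fun ω => ?_
  refine Set.indicator_apply_le' (fun hω => mul_le_sum_of_lt_maxClusterSize hK hh hω)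
    fun _ => Finset.sum_nonneg fun v _ => ?_
  exact sub_nonneg.2 (Real.exp_le_one_iff.2 (neg_nonpos.2 (by positivity)))

/-- The tail of the largest cluster for weights that are nearly critical. -/
theorem norrosReittu_real_le (w : Fin n → ℝ≥0) {K δ : ℝ} (hK : 0 < K) (hδ : 0 ≤ δ)
    (hw : ∑ v, (w v : ℝ) ^ 2 ≤ ∑ v, (w v : ℝ) + δ) (hl : ∑ v, (w v : ℝ) ≤ n) :
    (norrosReittu w).real {G | K < maxClusterSize G}
      ≤ 2 * (n / K ^ 2 + 4 * δ / K + 2 * (n / (K * √K))) := by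
  -- The choice `h = 1/K` makes `1 - exp (-(h * K))` a constant, at least `1/2`.
  have h₁ := (norrosReittu_real_mul_le w hK.le (inv_nonneg.2 hK.le)).trans
    (sum_ghostProb_le w (inv_nonneg.2 hK.le) hδ hw)
  rw [inv_mul_cancel₀ hK.ne', Real.sqrt_inv] at h₁
  have he : Real.exp (-1) ≤ 1 / 2 := by
    rw [Real.exp_neg, ← one_div]
    exact one_div_le_one_div_of_le two_pos (by linarith [Real.add_one_le_exp 1])
  set p := (norrosReittu w).real {G | K < maxClusterSize G}
  have hp : 0 ≤ p := measureReal_nonneg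
  have hsK : 0 < √K := Real.sqrt_pos.2 hK
  have h₂ : p * (K * (1 / 2)) ≤ n * K⁻¹ + (4 * δ + 2 * n * (√K)⁻¹) := by
    refine le_trans (mul_le_mul_of_nonneg_left ?_ hp) (h₁.trans ?_)
    · exact mul_le_mul_of_nonneg_left (by linarith) hK.le
    · gcongr
  have h₃ : 2 * (n / K ^ 2 + 4 * δ / K + 2 * (n / (K * √K)))
      = (n * K⁻¹ + (4 * δ + 2 * n * (√K)⁻¹)) / (K * (1 / 2)) := by
    field_simp
    ring
  rw [h₃, le_div_iff₀ (by positivity)]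
  exact h₂

end LargestCluster

/-! ### Quantile weights and Riemann sums. -/

section Weights

variable {μ : Measure ℝ}

theorem cdf_eq_zero [IsProbabilityMeasure μ] (hμ : μ (Set.Iic 0) = 0) {s : ℝ} (hs : s ≤ 0) :
    cdf μ s = 0 := by
  rw [cdf_eq_real, measureReal_def, measure_mono_null (Set.Iic_subset_Iic.2 hs) hμ,
    ENNReal.toReal_zero]

theorem tailInv_set_nonempty (μ : Measure ℝ) {u : ℝ} (hu : 0 < u) :
    {s : ℝ | 0 < s ∧ 1 - cdf μ s ≤ u}.Nonempty := by
  have h := (tendsto_cdf_atTop μ).eventually (lt_mem_nhds (show 1 - u < 1 by linarith))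
  obtain ⟨s, hs, hs0⟩ := (h.and (eventually_gt_atTop 0)).exists
  exact ⟨s, hs0, by linarith⟩

theorem tailInv_set_bddBelow (μ : Measure ℝ) (u : ℝ) :
    BddBelow {s : ℝ | 0 < s ∧ 1 - cdf μ s ≤ u} :=
  ⟨0, fun _ hs => hs.1.le⟩

theorem tailInv_antitoneOn (μ : Measure ℝ) : AntitoneOn (tailInv μ) (Set.Ioi 0) :=
  fun _ hu v _ huv => csInf_le_csInf (tailInv_set_bddBelow μ v) (tailInv_set_nonempty μ hu)
    fun _ hs => ⟨hs.1, hs.2.trans huv⟩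

/-- Right continuity of the distribution function lets the tail bound pass to the infimum. The
condition `u < 1` excludes `s ≤ 0`, where the tail equals `1`. -/
theorem tailInv_le_iff [IsProbabilityMeasure μ] (hμ : μ (Set.Iic 0) = 0) {u s : ℝ}
    (hu : u ∈ Set.Ioo (0 : ℝ) 1) : tailInv μ u ≤ s ↔ 1 - cdf μ s ≤ u := by
  constructor
  · intro h
    have hright : Tendsto (fun x => 1 - cdf μ x) (nhdsWithin s (Set.Ioi s))
        (nhds (1 - cdf μ s)) :=
      tendsto_const_nhds.sub (((cdf μ).right_continuous s).tendsto.mono_left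
        (nhdsWithin_mono _ Set.Ioi_subset_Ici_self))
    refine le_of_tendsto hright (eventually_nhdsWithin_of_forall fun x hx => ?_)
    obtain ⟨y, hy, hyx⟩ := exists_lt_of_csInf_lt (tailInv_set_nonempty μ hu.1)
      (show tailInv μ u < x from h.trans_lt hx)
    linarith [hy.2, monotone_cdf μ hyx.le]
  · intro h
    have hs : 0 < s := by
      by_contra! hs
      rw [cdf_eq_zero hμ hs] at h
      linarith [hu.2]
    exact csInf_le (tailInv_set_bddBelow μ u) ⟨hs, h⟩

theorem aemeasurable_tailInv (μ : Measure ℝ) :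
    AEMeasurable (tailInv μ) (volume.restrict (Set.Ioo 0 1)) :=
  aemeasurable_restrict_of_antitoneOn measurableSet_Ioo
    ((tailInv_antitoneOn μ).mono fun _ hu => hu.1)

/-- Inverse transform sampling. -/
theorem map_tailInv [IsProbabilityMeasure μ] (hμ : μ (Set.Iic 0) = 0) :
    (volume.restrict (Set.Ioo (0 : ℝ) 1)).map (tailInv μ) = μ := by
  symm
  refine Measure.ext_of_Iic _ _ fun s => ?_
  rw [Measure.map_apply_of_aemeasurable (aemeasurable_tailInv μ) measurableSet_Iic,
    Measure.restrict_apply' measurableSet_Ioo, ← ofReal_cdf]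
  have h0 := cdf_nonneg μ s
  have h1 := cdf_le_one μ s
  apply le_antisymm
  · calc ENNReal.ofReal (cdf μ s) = volume (Set.Ioo (1 - cdf μ s) 1) := by
          rw [Real.volume_Ioo]; congr 1; ring
      _ ≤ _ := measure_mono fun u hu => by
          have hu' : u ∈ Set.Ioo (0 : ℝ) 1 := ⟨by linarith [hu.1], hu.2⟩
          exact ⟨(tailInv_le_iff hμ hu').2 hu.1.le, hu'⟩
  · calc _ ≤ volume (Set.Icc (1 - cdf μ s) 1) := measure_mono fun u hu =>
          ⟨(tailInv_le_iff hμ hu.2).1 hu.1, hu.2.2.le⟩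
      _ = _ := by rw [Real.volume_Icc]; congr 1; ring

theorem integral_tailInv_comp [IsProbabilityMeasure μ] (hμ : μ (Set.Iic 0) = 0) {f : ℝ → ℝ}
    (hf : Continuous f) : ∫ u in (0 : ℝ)..1, f (tailInv μ u) = ∫ x, f x ∂μ := by
  rw [intervalIntegral.integral_of_le zero_le_one, integral_Ioc_eq_integral_Ioo]
  conv_rhs => rw [← map_tailInv hμ]
  exact (integral_map (aemeasurable_tailInv μ) hf.aestronglyMeasurable).symm

theorem intervalIntegrable_tailInv_comp [IsProbabilityMeasure μ] (hμ : μ (Set.Iic 0) = 0)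
    {f : ℝ → ℝ} (hf : Integrable f μ) :
    IntervalIntegrable (fun u => f (tailInv μ u)) volume 0 1 := by
  rw [intervalIntegrable_iff_integrableOn_Ioo_of_le zero_le_one]
  rw [← map_tailInv hμ] at hf
  exact hf.comp_aemeasurable (aemeasurable_tailInv μ)

variable {φ : ℝ → ℝ} {n : ℕ}

theorem natCast_div_mem_Icc {i : ℕ} (hi : i ≤ n) : (i / n : ℝ) ∈ Set.Icc (0 : ℝ) 1 :=
  ⟨by positivity, div_le_one_of_le₀ (Nat.cast_le.2 hi) (Nat.cast_nonneg n)⟩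

theorem intervalIntegrable_natCast_div (hint : IntervalIntegrable φ volume 0 1) {i j : ℕ}
    (hi : i ≤ n) (hj : j ≤ n) : IntervalIntegrable φ volume (i / n : ℝ) (j / n) := by
  refine hint.mono_set ?_
  rw [Set.uIcc_of_le zero_le_one]
  exact Set.uIcc_subset_Icc (natCast_div_mem_Icc hi) (natCast_div_mem_Icc hj)

theorem succ_div_sub (i : ℕ) : ((i + 1 : ℕ) / n : ℝ) - i / n = 1 / n := by
  push_cast; ring

/-- A right Riemann sum of a decreasing function is at most the integral. -/
theorem sum_le_integral_of_antitoneOn (hn : 0 < n) (hφ : AntitoneOn φ (Set.Ioi 0))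
    (hint : IntervalIntegrable φ volume 0 1) :
    ∑ i : Fin n, φ (((i : ℕ) + 1 : ℝ) / n) ≤ n * ∫ u in (0 : ℝ)..1, φ u := by
  have hn' : (0 : ℝ) < n := Nat.cast_pos.2 hn
  have hadj := intervalIntegral.sum_integral_adjacent_intervals (f := φ) (μ := volume)
    (a := fun i : ℕ => (i / n : ℝ)) (n := n)
    fun k hk => intervalIntegrable_natCast_div hint hk.le hk
  simp only [Nat.cast_zero, zero_div, div_self hn'.ne'] at hadj
  rw [← hadj, Finset.mul_sum, Fin.sum_univ_eq_sum_range fun i => φ (((i : ℕ) + 1 : ℝ) / n)]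
  refine Finset.sum_le_sum fun i hi => ?_
  have hin : i < n := Finset.mem_range.1 hi
  have hle : (i / n : ℝ) ≤ ((i + 1 : ℕ) / n : ℝ) := by gcongr; simp
  have h := intervalIntegral.integral_mono_on_of_le_Ioo (μ := volume) hle
    (f := fun _ => φ ((i + 1 : ℕ) / n : ℝ)) (g := φ) intervalIntegrable_const
    (intervalIntegrable_natCast_div hint hin.le hin) fun u hu => by
      have hu0 : 0 < u := lt_of_le_of_lt (by positivity) hu.1
      exact hφ hu0 (hu0.trans hu.2) hu.2.le
  rw [intervalIntegral.integral_const, succ_div_sub, smul_eq_mul] at h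
  push_cast at h ⊢
  calc _ = n * (1 / n * φ ((i + 1) / n)) := by field_simp
    _ ≤ _ := by gcongr

/-- A right Riemann sum of a decreasing function is at least the integral without the first
interval of the subdivision. -/
theorem integral_le_sum_of_antitoneOn (hn : 0 < n) (hφ : AntitoneOn φ (Set.Ioi 0))
    (hφ0 : ∀ u, 0 ≤ φ u) (hint : IntervalIntegrable φ volume 0 1) :
    n * ∫ u in (1 / n : ℝ)..1, φ u ≤ ∑ i : Fin n, φ (((i : ℕ) + 1 : ℝ) / n) := by
  obtain ⟨m, rfl⟩ : ∃ m, n = m + 1 := ⟨n - 1, by omega⟩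
  set N := m + 1 with hN
  have hn' : (0 : ℝ) < N := Nat.cast_pos.2 hn
  have hadj := intervalIntegral.sum_integral_adjacent_intervals (f := φ) (μ := volume)
    (a := fun i : ℕ => ((i + 1 : ℕ) / N : ℝ)) (n := m)
    fun k hk => intervalIntegrable_natCast_div hint (by omega) (by omega)
  simp only [zero_add, Nat.cast_one, ← hN, div_self hn'.ne'] at hadj
  rw [← hadj, Finset.mul_sum, Fin.sum_univ_eq_sum_range fun i => φ (((i : ℕ) + 1 : ℝ) / N),
    hN, Finset.sum_range_succ, ← hN]
  refine le_add_of_le_of_nonneg (Finset.sum_le_sum fun i hi => ?_) (hφ0 _)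
  have hin : i < m := Finset.mem_range.1 hi
  have hle : ((i + 1 : ℕ) / N : ℝ) ≤ ((i + 1 + 1 : ℕ) / N : ℝ) := by gcongr; simp
  have h := intervalIntegral.integral_mono_on_of_le_Ioo (μ := volume) hle
    (g := fun _ => φ ((i + 1 : ℕ) / N : ℝ)) (f := φ)
    (intervalIntegrable_natCast_div hint (by omega) (by omega)) intervalIntegrable_const
    fun u hu => by
      have h0 : (0 : ℝ) < (i + 1 : ℕ) / N := by positivity
      exact hφ h0 (h0.trans hu.1) hu.1.le
  rw [intervalIntegral.integral_const, succ_div_sub, smul_eq_mul] at h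
  calc N * ∫ u in ((i + 1 : ℕ) / N : ℝ)..((i + 1 + 1 : ℕ) / N : ℝ), φ u
      ≤ N * (1 / N * φ ((i + 1 : ℕ) / N)) := by gcongr
    _ = _ := by push_cast; field_simp

/-- The weights of a critical law are nearly critical. -/
theorem weight_bounds [IsProbabilityMeasure μ] (hμ : μ (Set.Iic 0) = 0) (hν : nu μ = 1)
    (hn : 0 < n) :
    ∑ v, (weight μ n v : ℝ) ≤ n ∧
      ∑ v, (weight μ n v : ℝ) ^ 2 ≤ ∑ v, (weight μ n v : ℝ) + √n := by
  have hn' : (0 : ℝ) < n := Nat.cast_pos.2 hn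
  set m := ∫ x, x ∂μ with hm
  -- Division by zero would give `nu μ = 0`. Since `m ≠ 0`, both moments are integrable: a
  -- non-integrable function has integral `0` by convention.
  have hm0 : m ≠ 0 := by
    intro h
    simp [nu, ← hm, h] at hν
  have hm2 : ∫ x, x ^ 2 ∂μ = m := by
    rw [nu, ← hm, div_eq_one_iff_eq hm0] at hν
    exact hν
  have hi2 : Integrable (fun x : ℝ => x ^ 2) μ := by
    by_contra h
    exact hm0 (hm2 ▸ integral_undef h)
  have hi1 : Integrable (fun x : ℝ => x) μ := by
    by_contra h
    exact hm0 (integral_undef h)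
  -- Both moments equal `m`, so `2x ≤ x² + 1` integrates to `2m ≤ m + 1`.
  have hm1 : m ≤ 1 := by
    have h : ∫ x, 2 * x ∂μ ≤ ∫ x, (x ^ 2 + 1) ∂μ :=
      integral_mono (hi1.const_mul 2) (hi2.add (integrable_const 1)) fun x => by
        change 2 * x ≤ x ^ 2 + 1
        nlinarith [sq_nonneg (x - 1)]
    rw [integral_const_mul, integral_add hi2 (integrable_const 1), hm2, ← hm] at h
    simp at h
    linarith
  have hg1 := intervalIntegrable_tailInv_comp hμ hi1
  have hg2 := intervalIntegrable_tailInv_comp hμ hi2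
  have hI1 : ∫ u in (0 : ℝ)..1, tailInv μ u = m := integral_tailInv_comp hμ continuous_id
  have hI2 : ∫ u in (0 : ℝ)..1, tailInv μ u ^ 2 = m :=
    (integral_tailInv_comp hμ (continuous_pow 2)).trans hm2
  have ha1 := tailInv_antitoneOn μ
  have ha2 : AntitoneOn (fun u => tailInv μ u ^ 2) (Set.Ioi 0) := fun u hu v hv huv =>
    pow_le_pow_left₀ (tailInv_nonneg μ v) (ha1 hu hv huv) 2
  have hS1 := sum_le_integral_of_antitoneOn hn ha1 hg1
  have hS2 := sum_le_integral_of_antitoneOn hn ha2 hg2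
  have hS3 := integral_le_sum_of_antitoneOn hn ha1 (tailInv_nonneg μ) hg1
  rw [hI1] at hS1
  rw [hI2] at hS2
  refine ⟨hS1.trans (by nlinarith), hS2.trans ?_⟩
  refine le_trans ?_ (add_le_add_left hS3 _)
  have hmem : (1 / n : ℝ) ∈ Set.Icc (0 : ℝ) 1 := by
    simpa using natCast_div_mem_Icc (i := 1) (n := n) hn
  have hsub : ∀ {f : ℝ → ℝ}, IntervalIntegrable f volume 0 1 →
      IntervalIntegrable f volume 0 (1 / n : ℝ) ∧ IntervalIntegrable f volume (1 / n : ℝ) 1 := by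
    intro f hf
    constructor <;> refine hf.mono_set ?_ <;> rw [Set.uIcc_of_le zero_le_one]
    · exact Set.uIcc_subset_Icc ⟨le_rfl, zero_le_one⟩ hmem
    · exact Set.uIcc_subset_Icc hmem ⟨zero_le_one, le_rfl⟩
  have hs : 0 < √(n : ℝ) := Real.sqrt_pos.2 hn'
  have hss : √(n : ℝ) * √n = n := Real.mul_self_sqrt hn'.le
  have hsplit := intervalIntegral.integral_add_adjacent_intervals (hsub hg1).1 (hsub hg1).2
  have hsplit2 := intervalIntegral.integral_add_adjacent_intervals (hsub hg2).1 (hsub hg2).2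
  have htail2 : 0 ≤ ∫ u in (1 / n : ℝ)..1, tailInv μ u ^ 2 :=
    intervalIntegral.integral_nonneg hmem.2 fun u _ => sq_nonneg _
  -- The first cell is what the lower Riemann bound loses. Here `2√n x ≤ n + x²` on a cell of length
  -- `1/n`, and `m ≤ 1` makes the loss at most `√n`.
  have hfirst : 2 * √n * ∫ u in (0 : ℝ)..(1 / n : ℝ), tailInv μ u ≤ 1 + m := by
    rw [← intervalIntegral.integral_const_mul]
    calc _ ≤ ∫ u in (0 : ℝ)..(1 / n : ℝ), (n + tailInv μ u ^ 2) := by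
          refine intervalIntegral.integral_mono_on hmem.1 ((hsub hg1).1.const_mul _)
            (intervalIntegrable_const.add (hsub hg2).1) fun u _ => ?_
          nlinarith [sq_nonneg (√n - tailInv μ u)]
      _ = 1 + ∫ u in (0 : ℝ)..(1 / n : ℝ), tailInv μ u ^ 2 := by
          rw [intervalIntegral.integral_add intervalIntegrable_const (hsub hg2).1,
            intervalIntegral.integral_const]
          simp [hn'.ne']
      _ ≤ 1 + m := by linarith
  rw [← hI1, ← hsplit, mul_add]
  have : n * ∫ u in (0 : ℝ)..(1 / n : ℝ), tailInv μ u ≤ √n := by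
    nlinarith
  linarith

end Weights

end CriticalNR

/-! ### Choice of scale and conclusion. -/

theorem proposition3 (cF τ : ℝ) (hcF : 0 < cF) (hτ : 4 < τ) :
    ∃ c₃ : ℝ, 0 < c₃ ∧
      ∀ (μ : Measure ℝ) [IsProbabilityMeasure μ],
        μ (Set.Iic 0) = 0 →
        (∀ x : ℝ, 0 < x → 1 - cdf μ x ≤ cF * x ^ (-(τ - 1))) →
        CriticalNR.nu μ = 1 →
        ∀ A : ℝ, 1 < A → ∀ᶠ n : ℕ in atTop,
          (CriticalNR.norrosReittu (CriticalNR.weight μ n)).real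
              {G | ⌈A * (n : ℝ) ^ (2 / 3 : ℝ)⌉₊ < CriticalNR.maxClusterSize G}
            ≤ c₃ / A ^ (3 / 2 : ℝ) := by
  -- `8 = 2 * (1 + 1 + 2)`: each of the three terms of `norrosReittu_real_le`, without its
  -- coefficient `2` on the last, is at most `A^(-3/2)`.
  refine ⟨8, by norm_num, fun μ _ hμ _ hν A hA => ?_⟩
  have hA0 : 0 < A := zero_lt_one.trans hA
  have hlim : Tendsto (fun n : ℕ => (n : ℝ) ^ (-(1 / 6) : ℝ)) atTop (nhds 0) :=
    (tendsto_rpow_neg_atTop (by norm_num)).comp tendsto_natCast_atTop_atTop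
  -- The threshold at which the correction `4√n / K = 4 n^(-1/6) / A` drops below `A^(-3/2)`.
  have hAsmall : 0 < A / (4 * A ^ (3 / 2 : ℝ)) := by positivity
  filter_upwards [eventually_gt_atTop 0, hlim.eventually (gt_mem_nhds hAsmall)] with n hn hsmall
  have hn' : (0 : ℝ) < n := Nat.cast_pos.2 hn
  have hn1 : (1 : ℝ) ≤ n := Nat.one_le_cast.2 hn
  set K := A * (n : ℝ) ^ (2 / 3 : ℝ) with hK
  have hK0 : 0 < K := by positivity
  obtain ⟨hl, hw⟩ := CriticalNR.weight_bounds hμ hν hn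
  have hle := CriticalNR.norrosReittu_real_le (CriticalNR.weight μ n) hK0 (Real.sqrt_nonneg n)
    hw hl
  have hmono : (CriticalNR.norrosReittu (CriticalNR.weight μ n)).real
      {G | ⌈K⌉₊ < CriticalNR.maxClusterSize G}
      ≤ (CriticalNR.norrosReittu (CriticalNR.weight μ n)).real
        {G | K < CriticalNR.maxClusterSize G} :=
    measureReal_mono fun G hG => (Nat.le_ceil K).trans_lt (Nat.cast_lt.2 hG)
  refine hmono.trans (hle.trans ?_)
  have hKsqrt : K * √K = A ^ (3 / 2 : ℝ) * n := by
    have h₁ : K * √K = K ^ (3 / 2 : ℝ) := by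
      rw [Real.sqrt_eq_rpow, show (3 / 2 : ℝ) = 1 + 1 / 2 by norm_num, Real.rpow_add hK0,
        Real.rpow_one]
    rw [h₁, hK, Real.mul_rpow hA0.le (by positivity), ← Real.rpow_mul hn'.le]
    norm_num
  have hKone : 1 ≤ K := by
    have := Real.one_le_rpow hn1 (show (0 : ℝ) ≤ 2 / 3 by norm_num)
    nlinarith
  have h₁ : n / (K * √K) = 1 / A ^ (3 / 2 : ℝ) := by
    rw [hKsqrt]; field_simp
  have h₂ : n / K ^ 2 ≤ 1 / A ^ (3 / 2 : ℝ) := by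
    rw [← h₁, sq]
    have : √K ≤ K := by
      rw [Real.sqrt_le_left hK0.le]
      nlinarith
    gcongr
  have h₃ : 4 * √n / K ≤ 1 / A ^ (3 / 2 : ℝ) := by
    have e : 4 * √n / K = 4 * (n : ℝ) ^ (-(1 / 6) : ℝ) / A := by
      have : √(n : ℝ) = (n : ℝ) ^ (-(1 / 6) : ℝ) * (n : ℝ) ^ (2 / 3 : ℝ) := by
        rw [Real.sqrt_eq_rpow, ← Real.rpow_add hn']; norm_num
      rw [this, hK]
      field_simp
    rw [e, div_le_div_iff₀ hA0 (by positivity)]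
    rw [lt_div_iff₀ (by positivity)] at hsmall
    linarith
  rw [h₁]
  calc _ ≤ 2 * (1 / A ^ (3 / 2 : ℝ) + 1 / A ^ (3 / 2 : ℝ) + 2 * (1 / A ^ (3 / 2 : ℝ))) := by
        gcongr
    _ = _ := by ring
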